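/- **Graphs.** For $M,N,L\ge 1$ the Chimera graph $\mathcal C_{M,N,L}$ is an $M\times N$ grid of unit cells, each a complete bipartite graph $K_{L,L}$ whose two sides consist of $L$ "vertical" and $L$ "horizontal" vertices indexed by $0,\dots,L-1$. In addition, vertical vertices of equal index in vertically neighbouring cells are adjacent, and horizontal vertices of equal index in horizontally neighbouring cells are adjacent. (For size $0$ it is the empty graph.) $G\square H$ denotes the Cartesian product. A minor embedding of $G$ in $H$ assigns to every vertex of $G$ a nonempty connected set of vertices of $H$ (its chain) such that distinct chains are disjoint and chains of adjacent vertices are joined by an edge of $H$; $G$ is a minor of $H$ if such an assignment exists. **CPCG Embedding.** Rows (numbered downwards) and columns of cells are numbered from $0$. Put $K=\lceil m/L\rceil$, $d=\lceil K/2\rceil$. For $0\le t<n$, the $t$-th nexus, which hosts the $t$-th copy of $K_m$, is the triangle of cells $(td+a,\,td+b)$ with $a,b\ge 0$, $a+b<K$. Variable $j\in\{0,\dots,m-1\}$ of copy $t$ has group $r=\lfloor j/L\rfloor$ and index $k=j \bmod L$. Its chain consists of vertices of index $k$, namely horizontal vertices in row $td+r$ and vertical vertices in column $td+K-1-r$: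 inside the nexus, the horizontal ones in columns $td,\dots,td+K-1-r$ and the vertical ones in rows $td,\dots,td+r$; and, as buses to the edge of the $N\times N$ grid, if $r<d$ the horizontal ones in columns $>td+K-1-r$ and the vertical ones in rows $<td$, and if $r\ge d$ the horizontal ones in columns $<td$ and the vertical ones in rows $>td+r$. CPCG Embedding *embeds* $K_m\square K_n$ into $\mathcal C_{N,N,L}$ if, for this choice or for the one with the roles of the two factors $K_m,K_n$ exchanged, all nexuses lie inside the $N\times N$ grid and the chains form a minor embedding of $K_m\square K_n$ in $\mathcal C_{N,N,L}$. **Theorem.** Let $L\ge 2$ and $m,n\ge 1$ be integers such that one of $m,n$ is divisible by $2L$ and the other is odd. Then there is a smallest $N$ such that CPCG Embedding embeds $K_m\square K_n$ into $\mathcal C_{N,N,L}$. It is $N=\dfrac{m(n+1)}{2L}$ if $2L\mid m$ and $n$ is odd, and $N=\dfrac{n(m+1)}{2L}$ if $2L\mid n$ and $m$ is odd. It is optimal: $K_m\square K_n$ is a minor of $\mathcal C_{N,N,L}$, but not of $\mathcal C_{N',N',L}$ for any $N'<N$. -/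

import Mathlib

/-- `IsMinorEmbedding G H φ`: the sets `φ v` (the chains, or branch sets) exhibit `G` as a minor
of `H`. Each chain is connected (in particular nonempty), distinct chains are disjoint, and
adjacent vertices of `G` have chains that are joined by an edge of `H`. -/
structure IsMinorEmbedding {V W : Type*} (G : SimpleGraph V) (H : SimpleGraph W)
    (φ : V → Set W) : Prop where
  connected : ∀ v, (H.induce (φ v)).Connected
  disjoint : ∀ u v, u ≠ v → Disjoint (φ u) (φ v)
  adj : ∀ u v, G.Adj u v → ∃ x ∈ φ u, ∃ y ∈ φ v, H.Adj x y

/-- `G` is (isomorphic to) a minor of `H`. -/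
def IsMinor {V W : Type*} (G : SimpleGraph V) (H : SimpleGraph W) : Prop :=
  ∃ φ : V → Set W, IsMinorEmbedding G H φ

/-- The qubits of the Chimera graph: `(x, y, .inl k)` is the `k`-th vertical qubit and
`(x, y, .inr k)` the `k`-th horizontal qubit of the unit cell in row `x` and column `y`. -/
abbrev ChimeraVertex (M N L : ℕ) : Type := Fin M × Fin N × (Fin L ⊕ Fin L)

/-- Adjacency in the Chimera graph. The two sides of a unit cell form a `K_{L,L}`; vertical qubits
are coupled to the qubits with the same index in the cells directly above and below, horizontal
qubits to those in the cells directly to the left and to the right. -/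
def chimeraAdj (M N L : ℕ) : ChimeraVertex M N L → ChimeraVertex M N L → Prop
  | (x, y, .inl _), (x', y', .inr _) => x = x' ∧ y = y'
  | (x, y, .inr _), (x', y', .inl _) => x = x' ∧ y = y'
  | (x, y, .inl k), (x', y', .inl k') =>
      y = y' ∧ k = k' ∧ ((x : ℕ) + 1 = x' ∨ (x' : ℕ) + 1 = x)
  | (x, y, .inr k), (x', y', .inr k') =>
      x = x' ∧ k = k' ∧ ((y : ℕ) + 1 = y' ∨ (y' : ℕ) + 1 = y)

/-- The Chimera graph `C_{M,N,L}`: an `M × N` grid of `K_{L,L}` unit cells. -/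
def chimera (M N L : ℕ) : SimpleGraph (ChimeraVertex M N L) where
  Adj := chimeraAdj M N L
  symm := ⟨by
    rintro ⟨x, y, k | k⟩ ⟨x', y', k' | k'⟩ h <;> simp only [chimeraAdj] at h ⊢ <;>
      simp only [h, true_and] <;> omega⟩
  loopless := ⟨by
    rintro ⟨x, y, k | k⟩ h <;> simp only [chimeraAdj] at h <;> omega⟩

/-- The number of groups of at most `L` variables into which the `m` variables of one copy of `K_m`
are divided: variable `j` is the variable of index `j % L` in group number `j / L`. It is also the
side length of the triangular nexus. -/
def nexusSide (m L : ℕ) : ℕ := m ⌈/⌉ L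

/-- The distance along the diagonal between consecutive nexus instances. -/
def nexusShift (m L : ℕ) : ℕ := nexusSide m L ⌈/⌉ 2

/-- The unit cells of the nexus instance that hosts the `t`-th copy of `K_m`: a triangle of cells
with legs of length `nexusSide m L`, whose right-angled corner is the diagonal cell with both
coordinates `t * nexusShift m L`. -/
def nexusCells (m L t : ℕ) : Set (ℕ × ℕ) :=
  {c | ∃ a b, a + b < nexusSide m L ∧
    c = (t * nexusShift m L + a, t * nexusShift m L + b)}

/-- The part inside the nexus of the chain of variable `j` of the `t`-th copy of `K_m` (triangular
embedding): group `r` runs along row `r` and along column `nexusSide m L - 1 - r` of the nexus; the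
two parts meet in a cell of its hypotenuse. -/
def nexusChain (m L N j t : ℕ) : Set (ChimeraVertex N N L) :=
  {q | match q with
    | (x, y, .inl k) => (k : ℕ) = j % L ∧
        (y : ℕ) = t * nexusShift m L + (nexusSide m L - 1 - j / L) ∧
        t * nexusShift m L ≤ x ∧ (x : ℕ) ≤ t * nexusShift m L + j / L
    | (x, y, .inr k) => (k : ℕ) = j % L ∧
        (x : ℕ) = t * nexusShift m L + j / L ∧
        t * nexusShift m L ≤ y ∧
        (y : ℕ) ≤ t * nexusShift m L + (nexusSide m L - 1 - j / L)}

/-- The bus part of the chain of variable `j` of the `t`-th copy of `K_m` in the `N × N` chip. For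
the first half of the groups the buses run from the nexus upwards and to the right, for the second
half downwards and to the left, in all cases to the edge of the chip. -/
def busChain (m L N j t : ℕ) : Set (ChimeraVertex N N L) :=
  {q | match q with
    | (x, y, .inl k) => (k : ℕ) = j % L ∧
        (y : ℕ) = t * nexusShift m L + (nexusSide m L - 1 - j / L) ∧
        ((j / L < nexusShift m L ∧ (x : ℕ) < t * nexusShift m L) ∨
         (nexusShift m L ≤ j / L ∧ t * nexusShift m L + j / L < x))
    | (x, y, .inr k) => (k : ℕ) = j % L ∧
        (x : ℕ) = t * nexusShift m L + j / L ∧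
        ((j / L < nexusShift m L ∧
            t * nexusShift m L + (nexusSide m L - 1 - j / L) < y) ∨
         (nexusShift m L ≤ j / L ∧ (y : ℕ) < t * nexusShift m L))}

/-- The chains of CPCG Embedding in `C_{N,N,L}`, with `K_m` embedded in the nexus and `n` nexus
instances along the diagonal. -/
def cpcgChain (m n L N : ℕ) (v : Fin m × Fin n) : Set (ChimeraVertex N N L) :=
  nexusChain m L N v.1 v.2 ∪ busChain m L N v.1 v.2

/-- All `n` nexus instances for `K_m` lie within the `N × N` grid of unit cells. -/
def NexusesFit (m n L N : ℕ) : Prop :=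
  ∀ t < n, ∀ c ∈ nexusCells m L t, c.1 < N ∧ c.2 < N

/-- CPCG Embedding embeds `K_m □ K_n` into `C_{N,N,L}`: for one of the two factors as the graph
embedded in the nexus, the nexus instances fit on the chip and the chains are a minor embedding. -/
def CPCGEmbeds (m n L N : ℕ) : Prop :=
  (NexusesFit m n L N ∧
    IsMinorEmbedding (SimpleGraph.completeGraph (Fin m) □ SimpleGraph.completeGraph (Fin n))
      (chimera N N L) (cpcgChain m n L N)) ∨
  (NexusesFit n m L N ∧
    IsMinorEmbedding (SimpleGraph.completeGraph (Fin m) □ SimpleGraph.completeGraph (Fin n))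
      (chimera N N L) (fun v => cpcgChain n m L N v.swap))

/-!
Both halves of the optimality are about treewidth, the lower bound being expressed by brambles.

*No smaller grid.* In `K_m □ K_n` with `n` odd, consider the sets that consist of more than half of
the `n` vertices of one row. Each is a clique, and any two of them have a column in common, in which
their vertices are equal or adjacent; so they form a bramble. A set that meets all of them has at
least `(n + 1) / 2` elements in each row, hence at least `m * (n + 1) / 2` in all
(`brambleOrderGT_rowMajorities`). A minor embedding carries a bramble to a bramble of at least the
same order (`IsBramble.biUnion`, `BrambleOrderGT.biUnion`). On the other hand a bramble of
`C_{N,N,L}` can be met in `N * L + 1` vertices (`IsBramble.not_brambleOrderGT_chimera`). This is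
a search strategy with `N * L + 1` searchers: `N * L` of them occupy the horizontal qubits of
a column and move to the next column one by one, the additional one going first. When exactly one
column is occupied, its vertical qubits are cut off from everything else and fall apart into
separate lines; if the bramble has withdrawn into one of these, the searchers chase it along the
line, where each row that is left behind frees `L` of them. Comparing the orders gives
`m * (n + 1) ≤ 2 * (N * L + 1)`, and with `2 * L ∣ m` and `2 ≤ L` this is
`m * (n + 1) / (2 * L) ≤ N`.

*The chains.* For `m = 2 * L * p` a nexus has side `2 * p` and the nexuses are `p` apart, so `n` of
them occupy `p * (n + 1)` rows and columns. A row is then shared by at most two nexuses, and for one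
of them it carries groups of the first half, whose horizontal lines run to the right, for the other
one groups of the second half, whose lines run to the left; the same holds for columns. Therefore
the chains are disjoint. Two copies of a variable are coupled where their buses cross
(`isMinorEmbedding_cpcgChain`).
-/

/-! ### Brambles and how they pass from a minor to the host graph -/

/-- A bramble: a family of connected (in particular nonempty) vertex sets any two of which touch,
that is, share a vertex or are joined by an edge. -/
structure IsBramble {V : Type*} (G : SimpleGraph V) (B : Set (Set V)) : Prop where
  connected : ∀ b ∈ B, (G.induce b).Connected
  touch : ∀ b ∈ B, ∀ c ∈ B, ∃ u ∈ b, ∃ v ∈ c, u = v ∨ G.Adj u v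

/-- The order of `B` exceeds `k`: no `k` vertices meet all members of `B`. This is the usual notion
for finite `V` only, since `Set.ncard` is `0` on infinite sets. -/
def BrambleOrderGT {V : Type*} (B : Set (Set V)) (k : ℕ) : Prop :=
  ∀ X : Set V, X.ncard ≤ k → ∃ b ∈ B, Disjoint b X

lemma IsMinorEmbedding.nonempty {V W : Type*} {G : SimpleGraph V} {H : SimpleGraph W}
    {φ : V → Set W} (hφ : IsMinorEmbedding G H φ) (v : V) : (φ v).Nonempty :=
  Set.nonempty_coe_sort.1 (hφ.connected v).nonempty

/-- The chains of a connected set of vertices have a connected union: along a path from `v₀` to `v`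
in `S`, consecutive chains are joined by an edge. -/
lemma IsMinorEmbedding.connected_biUnion {V W : Type*} {G : SimpleGraph V} {H : SimpleGraph W}
    {φ : V → Set W} (hφ : IsMinorEmbedding G H φ) {S : Set V} (hS : (G.induce S).Connected) :
    (H.induce (⋃ v ∈ S, φ v)).Connected := by
  obtain ⟨v₀, hv₀⟩ := Set.nonempty_coe_sort.1 hS.nonempty
  obtain ⟨x₀, hx₀⟩ := hφ.nonempty v₀
  have key : ∀ v : S, (G.induce S).Reachable ⟨v₀, hv₀⟩ v →
      ∃ s ⊆ ⋃ v ∈ S, φ v, x₀ ∈ s ∧ φ v ⊆ s ∧ (H.induce s).Connected := by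
    intro v hv
    rw [SimpleGraph.reachable_iff_reflTransGen] at hv
    induction hv with
    | refl => exact ⟨φ v₀, Set.subset_biUnion_of_mem hv₀, hx₀, subset_rfl, hφ.connected v₀⟩
    | @tail b c _ hbc ih =>
      obtain ⟨s, hs, hxs, hbs, hconn⟩ := ih
      obtain ⟨x, hx, y, hy, hxy⟩ := hφ.adj b c hbc
      exact ⟨s ∪ φ c, Set.union_subset hs (Set.subset_biUnion_of_mem c.2), .inl hxs,
        Set.subset_union_right, SimpleGraph.connected_induce_union hconn.preconnected
          (hφ.connected c).preconnected (hbs hx) hy hxy⟩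
  refine H.induce_connected_of_patches x₀ (Set.mem_biUnion hv₀ hx₀) fun {x} hx => ?_
  obtain ⟨v, hv, hxv⟩ := Set.mem_iUnion₂.1 hx
  obtain ⟨s, hs, hxs, hvs, hconn⟩ := key ⟨v, hv⟩ (hS.preconnected _ _)
  exact ⟨s, hs, hxs, hvs hxv, hconn.preconnected _ _⟩

lemma IsBramble.biUnion {V W : Type*} {G : SimpleGraph V} {H : SimpleGraph W}
    {φ : V → Set W} (hφ : IsMinorEmbedding G H φ) {B : Set (Set V)} (hB : IsBramble G B) :
    IsBramble H ((fun b => ⋃ v ∈ b, φ v) '' B) where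
  connected := by
    rintro _ ⟨b, hb, rfl⟩
    exact hφ.connected_biUnion (hB.connected b hb)
  touch := by
    rintro _ ⟨b, hb, rfl⟩ _ ⟨c, hc, rfl⟩
    obtain ⟨u, hu, v, hv, rfl | huv⟩ := hB.touch b hb c hc
    · obtain ⟨x, hx⟩ := hφ.nonempty u
      exact ⟨x, Set.mem_biUnion hu hx, x, Set.mem_biUnion hv hx, .inl rfl⟩
    · obtain ⟨x, hx, y, hy, hxy⟩ := hφ.adj u v huv
      exact ⟨x, Set.mem_biUnion hu hx, y, Set.mem_biUnion hv hy, .inr hxy⟩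

/-- The chains are disjoint, so a set of vertices of the host meets at most as many chains as it has
elements. -/
lemma BrambleOrderGT.biUnion {V W : Type*} [Finite W] {G : SimpleGraph V} {H : SimpleGraph W}
    {φ : V → Set W} (hφ : IsMinorEmbedding G H φ) {B : Set (Set V)} {k : ℕ}
    (hB : BrambleOrderGT B k) : BrambleOrderGT ((fun b => ⋃ v ∈ b, φ v) '' B) k := by
  intro X hX
  set Y : Set V := {v | (φ v ∩ X).Nonempty}
  have hY : Y.ncard ≤ X.ncard := by
    have hchoice : ∀ v : V, ∃ x, v ∈ Y → x ∈ φ v ∩ X := by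
      intro v
      by_cases hv : v ∈ Y
      · exact ⟨hv.some, fun _ => hv.some_mem⟩
      · exact ⟨(hφ.nonempty v).some, fun h => absurd h hv⟩
    choose f hf using hchoice
    refine Set.ncard_le_ncard_of_injOn f (fun v hv => (hf v hv).2) (fun u hu v hv huv => ?_)
    by_contra hne
    exact Set.disjoint_left.1 (hφ.disjoint u v hne) (hf u hu).1 (huv ▸ (hf v hv).1)
  obtain ⟨b, hb, hdisj⟩ := hB Y (hY.trans hX)
  refine ⟨_, ⟨b, hb, rfl⟩, Set.disjoint_left.2 fun x hx hxX => ?_⟩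
  obtain ⟨v, hv, hxv⟩ := Set.mem_iUnion₂.1 hx
  exact Set.disjoint_left.1 hdisj hv ⟨x, hxv, hxX⟩

/-! ### A bramble in the product of two complete graphs -/

/-- The sets that consist of more than half of the vertices of one copy of `K_n` in
`K_m □ K_n`. -/
def rowMajorities (m n : ℕ) : Set (Set (Fin m × Fin n)) :=
  {b | ∃ (a : Fin m) (S : Finset (Fin n)), n < 2 * S.card ∧ b = {v | v.1 = a ∧ v.2 ∈ S}}

lemma isBramble_rowMajorities (m n : ℕ) :
    IsBramble (SimpleGraph.completeGraph (Fin m) □ SimpleGraph.completeGraph (Fin n))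
      (rowMajorities m n) where
  connected := by
    rintro _ ⟨a, S, hS, rfl⟩
    obtain ⟨t, ht⟩ : S.Nonempty := Finset.card_pos.1 (by omega)
    rw [SimpleGraph.connected_iff_exists_forall_reachable]
    refine ⟨⟨(a, t), rfl, ht⟩, ?_⟩
    rintro ⟨⟨a', t'⟩, rfl, ht'⟩
    by_cases h : t = t'
    · subst h; rfl
    · refine SimpleGraph.Adj.reachable ?_
      simpa [SimpleGraph.boxProd_adj] using h
  touch := by
    rintro _ ⟨a, S, hS, rfl⟩ _ ⟨a', S', hS', rfl⟩
    obtain ⟨t, ht⟩ : (S ∩ S').Nonempty := by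
      have h1 := Finset.card_union_add_card_inter S S'
      have h2 := Finset.card_le_univ (S ∪ S')
      rw [Fintype.card_fin] at h2
      exact Finset.card_pos.1 (by omega)
    rw [Finset.mem_inter] at ht
    refine ⟨(a, t), ⟨rfl, ht.1⟩, (a', t), ⟨rfl, ht.2⟩, ?_⟩
    by_cases h : a = a'
    · exact .inl (by rw [h])
    · exact .inr (by simpa [SimpleGraph.boxProd_adj] using h)

/-- A set that meets all row majorities has at least `(n + 1) / 2` elements in each of the `m`
rows. -/
lemma brambleOrderGT_rowMajorities {m n k : ℕ} (hn : Odd n) (hk : 2 * k < m * (n + 1)) :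
    BrambleOrderGT (rowMajorities m n) k := by
  classical
  intro X hX
  by_contra hcon
  simp only [not_exists, not_and] at hcon
  have hrow : ∀ a : Fin m, n + 1 ≤ 2 * {v ∈ X.toFinset | v.1 = a}.card := by
    intro a
    set S : Finset (Fin n) := {t | (a, t) ∉ X} with hSdef
    have hS : ¬ n < 2 * S.card := fun hS => hcon _ ⟨a, S, hS, rfl⟩ <| by
      refine Set.disjoint_left.2 ?_
      rintro ⟨_, t⟩ ⟨rfl, ht⟩ htX
      exact (Finset.mem_filter.1 ht).2 htX
    have hcompl : Sᶜ.card ≤ {v ∈ X.toFinset | v.1 = a}.card := by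
      refine Finset.card_le_card_of_injOn (fun t => (a, t)) (fun t ht => ?_)
        (fun t _ t' _ h => (Prod.ext_iff.1 h).2)
      simpa [hSdef] using ht
    rw [Finset.card_compl, Fintype.card_fin] at hcompl
    obtain ⟨l, rfl⟩ := hn
    omega
  have hsum : X.ncard = ∑ a : Fin m, {v ∈ X.toFinset | v.1 = a}.card := by
    rw [Set.ncard_eq_toFinset_card']
    exact Finset.card_eq_sum_card_fiberwise (fun _ _ => Finset.mem_univ _)
  have : m * (n + 1) ≤ 2 * X.ncard := by
    rw [hsum, Finset.mul_sum]
    calc m * (n + 1) = ∑ _a : Fin m, (n + 1) := by simp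
      _ ≤ _ := Finset.sum_le_sum fun a _ => hrow a
  omega

/-! ### Brambles in the Chimera graph -/

/-- A connected set `b` that meets `C` lies in `C` if no edge inside `b` leads out of `C`. -/
lemma subset_of_induce_connected {V : Type*} {G : SimpleGraph V} {b C : Set V}
    (hb : (G.induce b).Connected) {u : V} (hub : u ∈ b) (huC : u ∈ C)
    (hC : ∀ u ∈ C, ∀ v ∈ b, G.Adj u v → v ∈ C) : b ⊆ C := by
  have key : ∀ v : b, (G.induce b).Reachable ⟨u, hub⟩ v → v.1 ∈ C := by
    intro v hv
    rw [SimpleGraph.reachable_iff_reflTransGen] at hv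
    induction hv with
    | refl => exact huC
    | @tail c d _ hcd ih => exact hC _ ih _ d.2 hcd
  exact fun v hv => key ⟨v, hv⟩ (hb.preconnected _ _)

/-- Some member of the bramble lies in `C`, a set whose neighbours outside `C` all belong to a small
set `X`. Then the bramble can be followed into `C \ X`: the member that avoids `X` touches the one
in `C`, and it cannot leave `C`. -/
lemma IsBramble.exists_subset_diff {V : Type*} {G : SimpleGraph V} {B : Set (Set V)} {k : ℕ}
    (hB : IsBramble G B) (hk : BrambleOrderGT B k) {C X : Set V}
    (hC : ∃ b ∈ B, b ⊆ C) (hX : X.ncard ≤ k)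
    (hCX : ∀ u ∈ C, ∀ v, G.Adj u v → v ∈ C ∨ v ∈ X) :
    ∃ b ∈ B, b ⊆ C \ X := by
  obtain ⟨b, hb, hbC⟩ := hC
  obtain ⟨c, hc, hcX⟩ := hk X hX
  have hout : ∀ v ∈ c, v ∉ X := fun v hv => Set.disjoint_left.1 hcX hv
  obtain ⟨u, hu, v, hv, huv⟩ := hB.touch b hb c hc
  have hvC : v ∈ C := by
    rcases huv with rfl | huv
    · exact hbC hu
    · exact (hCX u (hbC hu) v huv).resolve_right (hout v hv)
  refine ⟨c, hc, fun w hw => ⟨?_, hout w hw⟩⟩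
  exact subset_of_induce_connected (hB.connected c hc) hv hvC
    (fun u hu v hv huv => (hCX u hu v huv).resolve_right (hout v hv)) hw

lemma IsBramble.nonempty {V : Type*} {G : SimpleGraph V} {B : Set (Set V)}
    (hB : IsBramble G B) {b : Set V} (hb : b ∈ B) : b.Nonempty :=
  Set.nonempty_coe_sort.1 (hB.connected b hb).nonempty

/-- The vertical qubits of index `k` in column `y`, from row `x` downwards. -/
def verticalRay (N L x : ℕ) (y : Fin N) (k : Fin L) : Set (ChimeraVertex N N L) :=
  {q | x ≤ q.1 ∧ q.2.1 = y ∧ q.2.2 = .inl k}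

/-- What separates the rays from row `x` and from row `x + 1` downwards from the rest of the graph:
the horizontal qubits of column `y` from row `x` downwards and the vertical qubits of index `k` in
the rows `x - 1` and `x`. -/
def rayBag (N L x : ℕ) (y : Fin N) (k : Fin L) : Set (ChimeraVertex N N L) :=
  {q | q.2.1 = y ∧ match q.2.2 with
    | .inl k' => k' = k ∧ ((q.1 : ℕ) = x ∨ (q.1 : ℕ) + 1 = x)
    | .inr _ => x ≤ q.1}

lemma ncard_rayBag_le (N L x : ℕ) (y : Fin N) (k : Fin L) :
    (rayBag N L x y k).ncard ≤ N * L + 1 := by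
  have hcard : (Set.univ : Set (Option (Fin N × Fin L))).ncard = N * L + 1 := by
    simp [Set.ncard_univ]
  rw [← hcard]
  -- The vertical qubit of row `x - 1` takes the place of a horizontal one above row `x`.
  refine Set.ncard_le_ncard_of_injOn (fun q => match q.2.2 with
    | .inl k' => if (q.1 : ℕ) = x then none else some (q.1, k')
    | .inr k' => some (q.1, k')) (fun _ _ => Set.mem_univ _) ?_
  rintro ⟨x₁, y₁, k₁ | k₁⟩ ⟨hy₁, h₁⟩ ⟨x₂, y₂, k₂ | k₂⟩ ⟨hy₂, h₂⟩ h <;>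
    simp only at hy₁ h₁ hy₂ h₂ h <;> subst hy₁ <;> subst hy₂
  · obtain ⟨rfl, h₁⟩ := h₁
    obtain ⟨rfl, h₂⟩ := h₂
    have : x₁ = x₂ := by
      ext
      split_ifs at h with h3 h4 h4
      · omega
      · simp at h
        simp [h]
    rw [this]
  · split_ifs at h with h3
    simp only [Option.some.injEq, Prod.mk.injEq] at h
    obtain ⟨rfl, rfl⟩ := h
    omega
  · split_ifs at h with h3
    simp only [Option.some.injEq, Prod.mk.injEq] at h
    obtain ⟨rfl, rfl⟩ := h
    omega
  · simp only [Option.some.injEq, Prod.mk.injEq] at h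
    obtain ⟨rfl, rfl⟩ := h
    rfl

/-- A bramble of order greater than `N * L + 1` cannot withdraw into a vertical line: it would be
driven down the line row by row until nothing is left. -/
lemma not_exists_subset_verticalRay {N L : ℕ} {B : Set (Set (ChimeraVertex N N L))}
    (hB : IsBramble (chimera N N L) B) (hk : BrambleOrderGT B (N * L + 1)) (y : Fin N) (k : Fin L)
    (d x : ℕ) (hd : N ≤ x + d) : ¬ ∃ b ∈ B, b ⊆ verticalRay N L x y k := by
  induction d generalizing x with
  | zero =>
    rintro ⟨b, hb, hbC⟩
    obtain ⟨q, hq⟩ := hB.nonempty hb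
    have := (hbC hq).1
    omega
  | succ d ih =>
    intro h
    obtain ⟨b, hb, hbC⟩ := hB.exists_subset_diff hk h (ncard_rayBag_le N L x y k) <| by
      rintro ⟨x₁, y₁, k₁ | k₁⟩ ⟨hx, hy, hk₁⟩ ⟨x₂, y₂, k₂ | k₂⟩ hadj
      · obtain ⟨rfl, rfl, h3⟩ := hadj
        obtain rfl := Sum.inl.inj hk₁
        simp only at hx hy
        by_cases hle : x ≤ x₂
        · exact .inl ⟨hle, hy, rfl⟩
        · exact .inr ⟨hy, rfl, .inr (by dsimp only; omega)⟩
      · obtain ⟨rfl, rfl⟩ := hadj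
        exact .inr ⟨hy, hx⟩
      · cases hk₁
      · cases hk₁
    refine ih (x + 1) (by omega) ⟨b, hb, fun q hq => ?_⟩
    obtain ⟨⟨hx, hy, hq1⟩, hq2⟩ := hbC hq
    refine ⟨?_, hy, hq1⟩
    by_contra hlt
    refine hq2 ⟨hy, ?_⟩
    rw [hq1]
    exact ⟨rfl, .inl (by omega)⟩

/-- The position of a horizontal qubit in the order by column, then row, then index. -/
def horizontalRank {N L : ℕ} (x y : Fin N) (k : Fin L) : ℕ :=
  finProdFinEquiv (y, finProdFinEquiv (x, k))

lemma horizontalRank_eq {N L : ℕ} (x y : Fin N) (k : Fin L) :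
    horizontalRank x y k = finProdFinEquiv (x, k) + N * L * y := rfl

/-- The part of the graph to the right of the window formed by the `N * L` horizontal qubits of rank
`s, …, s + N * L - 1`: the horizontal qubits of higher rank, and the vertical qubits of all columns
none of whose horizontal qubits has left the window. -/
def rightOfWindow (N L s : ℕ) : Set (ChimeraVertex N N L) :=
  {q | match q with
    | (_, y, .inl _) => s ≤ N * L * y
    | (x, y, .inr k) => s + N * L ≤ horizontalRank x y k}

/-- The horizontal qubits in the windows that start at `s` and at `s + 1`. -/
def windowBag (N L s : ℕ) : Set (ChimeraVertex N N L) :=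
  {q | match q with
    | (_, _, .inl _) => False
    | (x, y, .inr k) => s ≤ horizontalRank x y k ∧ horizontalRank x y k ≤ s + N * L}

lemma ncard_windowBag_le (N L s : ℕ) : (windowBag N L s).ncard ≤ N * L + 1 := by
  have hcard : ((Finset.Icc s (s + N * L) : Finset ℕ) : Set ℕ).ncard = N * L + 1 := by
    rw [Set.ncard_coe_finset, Nat.card_Icc]
    omega
  rw [← hcard]
  refine Set.ncard_le_ncard_of_injOn (fun q => match q with
    | (_, _, .inl _) => 0
    | (x, y, .inr k) => horizontalRank x y k) ?_ ?_ (Finset.finite_toSet _)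
  · rintro ⟨x, y, k | k⟩ hq
    · exact hq.elim
    · exact Finset.mem_coe.2 (Finset.mem_Icc.2 hq)
  · rintro ⟨x₁, y₁, k₁ | k₁⟩ h₁ ⟨x₂, y₂, k₂ | k₂⟩ h₂ h
    · exact h₁.elim
    · exact h₁.elim
    · exact h₂.elim
    · have h3 := finProdFinEquiv.injective (Fin.ext h)
      simp only [Prod.mk.injEq, EmbeddingLike.apply_eq_iff_eq] at h3
      obtain ⟨rfl, rfl, rfl⟩ := h3
      rfl

/-- A bramble of order greater than `N * L + 1` cannot lie to the right of the window: it would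
remain there as the window is shifted, until nothing is left. -/
lemma not_exists_subset_rightOfWindow {N L : ℕ} {B : Set (Set (ChimeraVertex N N L))}
    (hB : IsBramble (chimera N N L) B) (hk : BrambleOrderGT B (N * L + 1))
    (d s : ℕ) (hd : N * (N * L) ≤ s + d) : ¬ ∃ b ∈ B, b ⊆ rightOfWindow N L s := by
  induction d generalizing s with
  | zero =>
    rintro ⟨b, hb, hbC⟩
    obtain ⟨⟨x, y, k | k⟩, hq⟩ := hB.nonempty hb
    · have h1 : s ≤ N * L * y := hbC hq
      have h2 : N * L * (y + 1) ≤ N * L * N := Nat.mul_le_mul_left _ y.2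
      have h3 : 0 < N * L := Nat.mul_pos y.pos k.pos
      have h4 : N * (N * L) = N * L * N := by ring
      rw [mul_add] at h2
      omega
    · have h1 : s + N * L ≤ horizontalRank x y k := hbC hq
      have h2 : horizontalRank x y k < N * (N * L) := Fin.is_lt _
      omega
  | succ d ih =>
    intro h
    obtain ⟨b, hb, hbC⟩ := hB.exists_subset_diff hk h (ncard_windowBag_le N L s) <| by
      rintro ⟨x₁, y₁, k₁ | k₁⟩ h₁ ⟨x₂, y₂, k₂ | k₂⟩ hadj
      · obtain ⟨rfl, -, -⟩ := hadj
        exact .inl h₁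
      · obtain ⟨rfl, rfl⟩ := hadj
        have h1 : s ≤ N * L * y₁ := h₁
        have h2 := horizontalRank_eq x₁ y₁ k₂
        by_cases hle : s + N * L ≤ horizontalRank x₁ y₁ k₂
        · exact .inl hle
        · exact .inr ⟨by omega, by omega⟩
      · obtain ⟨rfl, rfl⟩ := hadj
        have h1 : s + N * L ≤ horizontalRank x₁ y₁ k₁ := h₁
        have h2 := horizontalRank_eq x₁ y₁ k₁
        have h3 := (finProdFinEquiv (x₁, k₁)).2
        exact .inl (by change s ≤ N * L * y₁; omega)
      · obtain ⟨rfl, rfl, hy⟩ := hadj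
        have h1 : s + N * L ≤ horizontalRank x₁ y₁ k₁ := h₁
        by_cases hle : s + N * L ≤ horizontalRank x₁ y₂ k₁
        · exact .inl hle
        · refine .inr ⟨?_, by omega⟩
          rw [horizontalRank_eq] at h1 ⊢
          rcases hy with hy | hy
          · rw [← hy, mul_add]
            omega
          · rw [← hy, mul_add] at h1
            omega
    by_cases hsub : b ⊆ rightOfWindow N L (s + 1)
    · exact ih (s + 1) (by omega) ⟨b, hb, hsub⟩
    -- Otherwise the window is a full column, and `b` lies in one of its vertical lines.
    obtain ⟨⟨x, y, k | k⟩, hq, hq'⟩ := Set.not_subset.1 hsub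
    · have hs1 : s ≤ N * L * y := (hbC hq).1
      have hs2 : ¬ s + 1 ≤ N * L * y := hq'
      refine not_exists_subset_verticalRay hB hk y k N 0 (by omega) ⟨b, hb, ?_⟩
      refine subset_of_induce_connected (hB.connected b hb) hq ⟨Nat.zero_le _, rfl, rfl⟩ ?_
      rintro ⟨x₁, y₁, k₁⟩ ⟨-, rfl, rfl⟩ ⟨x₂, y₂, k₂ | k₂⟩ hv hadj
      · obtain ⟨rfl, rfl, -⟩ := hadj
        exact ⟨Nat.zero_le _, rfl, rfl⟩
      · obtain ⟨rfl, rfl⟩ := hadj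
        have h2 := horizontalRank_eq x₁ y₁ k₂
        have h3 := (finProdFinEquiv (x₁, k₂)).2
        dsimp only at hs1 hs2
        exact absurd ⟨by omega, by omega⟩ (hbC hv).2
    · have h1 : s + N * L ≤ horizontalRank x y k := (hbC hq).1
      have h2 : ¬ s + 1 + N * L ≤ horizontalRank x y k := hq'
      exact (hbC hq).2 ⟨by omega, by omega⟩

/-- The bramble form of the fact that `C_{N,N,L}` has treewidth at most `N * L`. The sweep starts
with the window on column `0`, to the right of which lies all the rest of the graph. -/
lemma IsBramble.not_brambleOrderGT_chimera {N L : ℕ} {B : Set (Set (ChimeraVertex N N L))}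
    (hB : IsBramble (chimera N N L) B) : ¬ BrambleOrderGT B (N * L + 1) := by
  intro hk
  obtain ⟨b₀, hb₀, -⟩ := hk ∅ (by simp)
  obtain ⟨b, hb, hbC⟩ := hB.exists_subset_diff (C := Set.univ) hk ⟨b₀, hb₀, Set.subset_univ _⟩
    (ncard_windowBag_le N L 0) (fun _ _ _ _ => .inl (Set.mem_univ _))
  refine not_exists_subset_rightOfWindow hB hk (N * (N * L)) 0 (by omega) ⟨b, hb, fun q hq => ?_⟩
  obtain ⟨-, hq⟩ := hbC hq
  obtain ⟨x, y, k | k⟩ := q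
  · exact Nat.zero_le _
  · by_contra hlt
    have hlt' : ¬ 0 + N * L ≤ horizontalRank x y k := hlt
    exact hq ⟨by omega, by omega⟩

/-- The bramble of row majorities survives in `C_{N,N,L}`, where its order is limited. -/
lemma le_of_isMinor_chimera {m n L N : ℕ} (hn : Odd n)
    (h : IsMinor (SimpleGraph.completeGraph (Fin m) □ SimpleGraph.completeGraph (Fin n))
      (chimera N N L)) : m * (n + 1) ≤ 2 * (N * L + 1) := by
  by_contra hlt
  obtain ⟨φ, hφ⟩ := h
  exact ((isBramble_rowMajorities m n).biUnion hφ).not_brambleOrderGT_chimera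
    ((brambleOrderGT_rowMajorities hn (by omega)).biUnion hφ)

/-! ### The chains of CPCG Embedding when `2 * L` divides `m` -/

lemma nexusSide_two_mul {L : ℕ} (hL : 0 < L) (p : ℕ) : nexusSide (2 * L * p) L = 2 * p := by
  rw [nexusSide, show 2 * L * p = L * (2 * p) by ring, Nat.ceilDiv_eq_add_pred_div]
  rw [show L * (2 * p) + L - 1 = L - 1 + L * (2 * p) by omega, Nat.add_mul_div_left _ _ hL,
    Nat.div_eq_of_lt (by omega), zero_add]

lemma nexusShift_two_mul {L : ℕ} (hL : 0 < L) (p : ℕ) : nexusShift (2 * L * p) L = p := by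
  rw [nexusShift, nexusSide_two_mul hL, Nat.ceilDiv_eq_add_pred_div]
  omega

/-- Nexus and bus parts of the vertical line together. In the first `p` groups it runs from the top
edge of the chip down to the cell where it meets the horizontal line, in the last `p` groups from
the top row of the nexus down to the bottom edge. -/
lemma inl_mem_cpcgChain {L : ℕ} (hL : 0 < L) {p n N r : ℕ} (j : Fin (2 * L * p)) (t : Fin n)
    (x y : Fin N) (k : Fin L)
    (hr : (j : ℕ) / L = r) :
    (x, y, .inl k) ∈ cpcgChain (2 * L * p) n L N (j, t) ↔
      (k : ℕ) = j % L ∧ (y : ℕ) = t * p + (2 * p - 1 - r) ∧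
        ((r < p ∧ (x : ℕ) ≤ t * p + r) ∨ (p ≤ r ∧ t * p ≤ x)) := by
  simp only [cpcgChain, nexusChain, busChain, Set.mem_union, Set.mem_ofPred_eq,
    nexusSide_two_mul hL, nexusShift_two_mul hL, hr]
  omega

/-- Nexus and bus parts of the horizontal line together. In the first `p` groups it runs from the
leftmost column of the nexus to the right edge of the chip, in the last `p` groups from the left
edge to the cell where it meets the vertical line. -/
lemma inr_mem_cpcgChain {L : ℕ} (hL : 0 < L) {p n N r : ℕ} (j : Fin (2 * L * p)) (t : Fin n)
    (x y : Fin N) (k : Fin L)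
    (hr : (j : ℕ) / L = r) :
    (x, y, .inr k) ∈ cpcgChain (2 * L * p) n L N (j, t) ↔
      (k : ℕ) = j % L ∧ (x : ℕ) = t * p + r ∧
        ((r < p ∧ t * p ≤ y) ∨ (p ≤ r ∧ (y : ℕ) ≤ t * p + (2 * p - 1 - r))) := by
  simp only [cpcgChain, nexusChain, busChain, Set.mem_union, Set.mem_ofPred_eq,
    nexusSide_two_mul hL, nexusShift_two_mul hL, hr]
  omega

lemma val_div_lt_two_mul {L p : ℕ} (j : Fin (2 * L * p)) : (j : ℕ) / L < 2 * p := by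
  refine Nat.div_lt_of_lt_mul ?_
  rw [show L * (2 * p) = 2 * L * p by ring]
  exact j.2

/-- Nexus `t` ends within the first `p * (n + 1)` rows and columns. -/
lemma val_mul_add_le {n : ℕ} (t : Fin n) (p : ℕ) : (t : ℕ) * p + 2 * p ≤ p * (n + 1) := by
  calc (t : ℕ) * p + 2 * p = (t + 1 + 1) * p := by ring
    _ ≤ (n + 1) * p := Nat.mul_le_mul_right _ (by have := t.2; omega)
    _ = p * (n + 1) := mul_comm _ _

lemma nexusesFit_two_mul {L : ℕ} (hL : 0 < L) (p n : ℕ) :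
    NexusesFit (2 * L * p) n L (p * (n + 1)) := by
  rintro t ht _ ⟨a, b, hab, rfl⟩
  rw [nexusSide_two_mul hL] at hab
  rw [nexusShift_two_mul hL]
  have := val_mul_add_le ⟨t, ht⟩ p
  dsimp only at this ⊢
  omega

lemma reachable_vertical {M N L : ℕ} {s : Set (ChimeraVertex M N L)} (y : Fin N) (k : Fin L)
    (d : ℕ) (x x' : Fin M) (hd : (x : ℕ) + d = x')
    (hs : ∀ z : Fin M, x ≤ z → z ≤ x' → (z, y, .inl k) ∈ s) :
    ((chimera M N L).induce s).Reachable
      ⟨(x, y, .inl k), hs x le_rfl (Fin.le_def.2 (by omega))⟩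
      ⟨(x', y, .inl k), hs x' (Fin.le_def.2 (by omega)) le_rfl⟩ := by
  induction d generalizing x' with
  | zero =>
    obtain rfl : x = x' := Fin.ext (by omega)
    rfl
  | succ d ih =>
    have hlt : (x : ℕ) + d < M := by have := x'.2; omega
    refine (ih ⟨x + d, hlt⟩ rfl fun z hz hz' => hs z hz ?_).trans (SimpleGraph.Adj.reachable ?_)
    · rw [Fin.le_def] at hz' ⊢
      dsimp only at hz'
      omega
    · exact ⟨rfl, rfl, .inl (by dsimp only; omega)⟩

lemma reachable_horizontal {M N L : ℕ} {s : Set (ChimeraVertex M N L)} (x : Fin M) (k : Fin L)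
    (d : ℕ) (y y' : Fin N) (hd : (y : ℕ) + d = y')
    (hs : ∀ z : Fin N, y ≤ z → z ≤ y' → (x, z, .inr k) ∈ s) :
    ((chimera M N L).induce s).Reachable
      ⟨(x, y, .inr k), hs y le_rfl (Fin.le_def.2 (by omega))⟩
      ⟨(x, y', .inr k), hs y' (Fin.le_def.2 (by omega)) le_rfl⟩ := by
  induction d generalizing y' with
  | zero =>
    obtain rfl : y = y' := Fin.ext (by omega)
    rfl
  | succ d ih =>
    have hlt : (y : ℕ) + d < N := by have := y'.2; omega
    refine (ih ⟨y + d, hlt⟩ rfl fun z hz hz' => hs z hz ?_).trans (SimpleGraph.Adj.reachable ?_)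
    · rw [Fin.le_def] at hz' ⊢
      dsimp only at hz'
      omega
    · exact ⟨rfl, rfl, .inl (by dsimp only; omega)⟩

/-- A set of qubits is connected if it consists of an interval of a vertical line and an interval of
a horizontal line that meet in a common cell. -/
lemma connected_induce_of_lines {M N L : ℕ} {s : Set (ChimeraVertex M N L)}
    (x₀ : Fin M) (y₀ : Fin N) (k₀ l₀ : Fin L)
    (hv₀ : (x₀, y₀, .inl k₀) ∈ s) (hh₀ : (x₀, y₀, .inr l₀) ∈ s)
    (hv : ∀ x y k, (x, y, .inl k) ∈ s → y = y₀ ∧ k = k₀ ∧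
      ∀ z, (x ≤ z ∧ z ≤ x₀) ∨ (x₀ ≤ z ∧ z ≤ x) → (z, y₀, .inl k₀) ∈ s)
    (hh : ∀ x y k, (x, y, .inr k) ∈ s → x = x₀ ∧ k = l₀ ∧
      ∀ z, (y ≤ z ∧ z ≤ y₀) ∨ (y₀ ≤ z ∧ z ≤ y) → (x₀, z, .inr l₀) ∈ s) :
    ((chimera M N L).induce s).Connected := by
  rw [SimpleGraph.connected_iff_exists_forall_reachable]
  refine ⟨⟨_, hv₀⟩, ?_⟩
  rintro ⟨⟨x, y, k | k⟩, hq⟩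
  · obtain ⟨rfl, rfl, hz⟩ := hv x y k hq
    rcases le_total x x₀ with h | h
    · exact (reachable_vertical y k (x₀ - x) x x₀ (by rw [Fin.le_def] at h; omega)
        fun z h1 h2 => hz z (.inl ⟨h1, h2⟩)).symm
    · exact reachable_vertical y k (x - x₀) x₀ x (by rw [Fin.le_def] at h; omega)
        fun z h1 h2 => hz z (.inr ⟨h1, h2⟩)
  · obtain ⟨rfl, rfl, hz⟩ := hh x y k hq
    refine (SimpleGraph.Adj.reachable
      (show ((chimera M N L).induce s).Adj ⟨_, hv₀⟩ ⟨_, hh₀⟩ from ⟨rfl, rfl⟩)).trans ?_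
    rcases le_total y y₀ with h | h
    · exact (reachable_horizontal x k (y₀ - y) y y₀ (by rw [Fin.le_def] at h; omega)
        fun z h1 h2 => hz z (.inl ⟨h1, h2⟩)).symm
    · exact reachable_horizontal x k (y - y₀) y₀ y (by rw [Fin.le_def] at h; omega)
        fun z h1 h2 => hz z (.inr ⟨h1, h2⟩)

lemma connected_cpcgChain {L : ℕ} (hL : 0 < L) {p n : ℕ} (v : Fin (2 * L * p) × Fin n) :
    ((chimera (p * (n + 1)) (p * (n + 1)) L).induce
      (cpcgChain (2 * L * p) n L (p * (n + 1)) v)).Connected := by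
  obtain ⟨j, t⟩ := v
  obtain ⟨r, hr⟩ : ∃ r, (j : ℕ) / L = r := ⟨_, rfl⟩
  have hrp : r < 2 * p := hr ▸ val_div_lt_two_mul j
  have hN := val_mul_add_le t p
  refine connected_induce_of_lines (⟨t * p + r, by omega⟩)
    (⟨t * p + (2 * p - 1 - r), by omega⟩) ⟨j % L, Nat.mod_lt _ hL⟩ ⟨j % L, Nat.mod_lt _ hL⟩
    ?_ ?_ ?_ ?_
  · rw [inl_mem_cpcgChain hL _ _ _ _ _ hr]
    dsimp only
    omega
  · rw [inr_mem_cpcgChain hL _ _ _ _ _ hr]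
    dsimp only
    omega
  · intro x y k h
    rw [inl_mem_cpcgChain hL _ _ _ _ _ hr] at h
    refine ⟨Fin.ext h.2.1, Fin.ext h.1, fun z hz => ?_⟩
    rw [inl_mem_cpcgChain hL _ _ _ _ _ hr]
    simp only [Fin.le_def] at hz
    refine ⟨rfl, rfl, ?_⟩
    omega
  · intro x y k h
    rw [inr_mem_cpcgChain hL _ _ _ _ _ hr] at h
    refine ⟨Fin.ext h.2.1, Fin.ext h.1, fun z hz => ?_⟩
    rw [inr_mem_cpcgChain hL _ _ _ _ _ hr]
    simp only [Fin.le_def] at hz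
    refine ⟨rfl, rfl, ?_⟩
    omega

/-- Lines of the same index in the same row (or column) that belong to different nexuses come from
consecutive nexuses, one from a group in the first half and the other from one in the second half;
their buses run in opposite directions. -/
lemma disjoint_cpcgChain {L : ℕ} (hL : 0 < L) {p n N : ℕ} {u v : Fin (2 * L * p) × Fin n}
    (huv : u ≠ v) :
    Disjoint (cpcgChain (2 * L * p) n L N u) (cpcgChain (2 * L * p) n L N v) := by
  obtain ⟨i, s⟩ := u
  obtain ⟨j, t⟩ := v
  obtain ⟨r, hri⟩ : ∃ r, (i : ℕ) / L = r := ⟨_, rfl⟩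
  have hrp : r < 2 * p := hri ▸ val_div_lt_two_mul i
  obtain ⟨r', hrj⟩ : ∃ r', (j : ℕ) / L = r' := ⟨_, rfl⟩
  have hrp' : r' < 2 * p := hrj ▸ val_div_lt_two_mul j
  have hne : ¬ (r = r' ∧ (i : ℕ) % L = j % L ∧ (s : ℕ) = t) := by
    rintro ⟨h1, h2, h3⟩
    refine huv (Prod.ext (Fin.ext ?_) (Fin.ext h3))
    rw [← Nat.div_add_mod (i : ℕ) L, hri, h1, h2, ← hrj, Nat.div_add_mod]
  have hst : (s : ℕ) = t ∨ (s : ℕ) + 1 = t ∨ (t : ℕ) + 1 = s ∨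
      (s : ℕ) + 2 ≤ t ∨ (t : ℕ) + 2 ≤ s := by omega
  -- The diagonal offsets `s * p` and `t * p`, compared linearly.
  have hmul : ((s : ℕ) = t ∧ (s : ℕ) * p = t * p) ∨ (s : ℕ) * p + p = t * p ∨
      (t : ℕ) * p + p = s * p ∨ (s : ℕ) * p + 2 * p ≤ t * p ∨ (t : ℕ) * p + 2 * p ≤ s * p := by
    rcases hst with h | h | h | h | h
    · exact .inl ⟨h, by rw [h]⟩
    · exact .inr (.inl (by rw [← h]; ring))
    · exact .inr (.inr (.inl (by rw [← h]; ring)))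
    · refine .inr (.inr (.inr (.inl ?_)))
      rw [← add_mul]
      exact Nat.mul_le_mul_right _ h
    · refine .inr (.inr (.inr (.inr ?_)))
      rw [← add_mul]
      exact Nat.mul_le_mul_right _ h
  refine Set.disjoint_left.2 ?_
  rintro ⟨x, y, k | k⟩ h1 h2
  · rw [inl_mem_cpcgChain hL _ _ _ _ _ hri] at h1
    rw [inl_mem_cpcgChain hL _ _ _ _ _ hrj] at h2
    omega
  · rw [inr_mem_cpcgChain hL _ _ _ _ _ hri] at h1
    rw [inr_mem_cpcgChain hL _ _ _ _ _ hrj] at h2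
    omega

lemma exists_adj_of_mem_cell {M N L : ℕ} {A B : Set (ChimeraVertex M N L)} (x y : ℕ) (hx : x < M)
    (hy : y < N) (k l : Fin L) (hA : (⟨x, hx⟩, ⟨y, hy⟩, .inr k) ∈ A)
    (hB : (⟨x, hx⟩, ⟨y, hy⟩, .inl l) ∈ B) :
    ∃ q ∈ A, ∃ q' ∈ B, (chimera M N L).Adj q q' :=
  ⟨_, hA, _, hB, rfl, rfl⟩

/-- Within a copy, the horizontal line of the smaller group crosses the vertical line of the other
group. For equal groups the crossing is the cell of the hypotenuse that both chains turn in. -/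
lemma exists_adj_of_div_le {L : ℕ} (hL : 0 < L) {p n : ℕ} (i j : Fin (2 * L * p)) (t : Fin n)
    (hij : (i : ℕ) / L ≤ j / L) :
    ∃ q ∈ cpcgChain (2 * L * p) n L (p * (n + 1)) (i, t),
      ∃ q' ∈ cpcgChain (2 * L * p) n L (p * (n + 1)) (j, t),
        (chimera (p * (n + 1)) (p * (n + 1)) L).Adj q q' := by
  obtain ⟨r, hri⟩ : ∃ r, (i : ℕ) / L = r := ⟨_, rfl⟩
  have hrp : r < 2 * p := hri ▸ val_div_lt_two_mul i
  obtain ⟨r', hrj⟩ : ∃ r', (j : ℕ) / L = r' := ⟨_, rfl⟩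
  have hrp' : r' < 2 * p := hrj ▸ val_div_lt_two_mul j
  rw [hri, hrj] at hij
  have hN := val_mul_add_le t p
  refine exists_adj_of_mem_cell (t * p + r) (t * p + (2 * p - 1 - r')) (by omega) (by omega)
    ⟨i % L, Nat.mod_lt _ hL⟩ ⟨j % L, Nat.mod_lt _ hL⟩ ?_ ?_
  · rw [inr_mem_cpcgChain hL _ _ _ _ _ hri]
    dsimp only
    omega
  · rw [inl_mem_cpcgChain hL _ _ _ _ _ hrj]
    dsimp only
    omega

/-- Chains of the same variable in two copies are coupled where their buses cross. -/
lemma exists_adj_of_lt {L : ℕ} (hL : 0 < L) {p n : ℕ} (j : Fin (2 * L * p)) (s t : Fin n)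
    (hst : s < t) :
    ∃ q ∈ cpcgChain (2 * L * p) n L (p * (n + 1)) (j, s),
      ∃ q' ∈ cpcgChain (2 * L * p) n L (p * (n + 1)) (j, t),
        (chimera (p * (n + 1)) (p * (n + 1)) L).Adj q q' := by
  obtain ⟨r, hr⟩ : ∃ r, (j : ℕ) / L = r := ⟨_, rfl⟩
  have hrp : r < 2 * p := hr ▸ val_div_lt_two_mul j
  have hs := val_mul_add_le s p
  have ht := val_mul_add_le t p
  have hle : (s : ℕ) * p ≤ t * p := Nat.mul_le_mul_right _ (Fin.le_def.1 hst.le)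
  rcases lt_or_ge r p with h | h
  · refine exists_adj_of_mem_cell (s * p + r) (t * p + (2 * p - 1 - r)) (by omega)
      (by omega) ⟨j % L, Nat.mod_lt _ hL⟩ ⟨j % L, Nat.mod_lt _ hL⟩ ?_ ?_
    · rw [inr_mem_cpcgChain hL _ _ _ _ _ hr]
      dsimp only
      omega
    · rw [inl_mem_cpcgChain hL _ _ _ _ _ hr]
      dsimp only
      omega
  · obtain ⟨q, hq, q', hq', hadj⟩ := exists_adj_of_mem_cell
      (A := cpcgChain (2 * L * p) n L (p * (n + 1)) (j, t))
      (B := cpcgChain (2 * L * p) n L (p * (n + 1)) (j, s))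
      (t * p + r) (s * p + (2 * p - 1 - r)) (by omega) (by omega)
      ⟨j % L, Nat.mod_lt _ hL⟩ ⟨j % L, Nat.mod_lt _ hL⟩
      (by rw [inr_mem_cpcgChain hL _ _ _ _ _ hr]; dsimp only; omega)
      (by rw [inl_mem_cpcgChain hL _ _ _ _ _ hr]; dsimp only; omega)
    exact ⟨q', hq', q, hq, hadj.symm⟩

lemma isMinorEmbedding_cpcgChain {L : ℕ} (hL : 0 < L) (p n : ℕ) :
    IsMinorEmbedding
      (SimpleGraph.completeGraph (Fin (2 * L * p)) □ SimpleGraph.completeGraph (Fin n))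
      (chimera (p * (n + 1)) (p * (n + 1)) L) (cpcgChain (2 * L * p) n L (p * (n + 1))) where
  connected v := connected_cpcgChain hL v
  disjoint _ _ huv := disjoint_cpcgChain hL huv
  adj := by
    rintro ⟨i, s⟩ ⟨j, t⟩ (⟨-, hst⟩ | ⟨hst, hij⟩)
    · obtain rfl : s = t := hst
      rcases le_total ((i : ℕ) / L) (j / L) with h | h
      · exact exists_adj_of_div_le hL i j s h
      · obtain ⟨q, hq, q', hq', hadj⟩ := exists_adj_of_div_le hL j i s h
        exact ⟨q', hq', q, hq, hadj.symm⟩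
    · obtain rfl : i = j := hij
      rcases lt_or_gt_of_ne (show s ≠ t from hst) with h | h
      · exact exists_adj_of_lt hL i s t h
      · obtain ⟨q, hq, q', hq', hadj⟩ := exists_adj_of_lt hL i t s h
        exact ⟨q', hq', q, hq, hadj.symm⟩

/-! ### Optimality -/

lemma IsMinorEmbedding.comp_iso {U V W : Type*} {F : SimpleGraph U} {G : SimpleGraph V}
    {H : SimpleGraph W} {φ : V → Set W} (hφ : IsMinorEmbedding G H φ) (e : F ≃g G) :
    IsMinorEmbedding F H (fun u => φ (e u)) where
  connected u := hφ.connected (e u)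
  disjoint _ _ huv := hφ.disjoint _ _ (e.injective.ne huv)
  adj _ _ huv := hφ.adj _ _ (e.map_adj_iff.2 huv)

lemma CPCGEmbeds.isMinor {m n L N : ℕ} (h : CPCGEmbeds m n L N) :
    IsMinor (SimpleGraph.completeGraph (Fin m) □ SimpleGraph.completeGraph (Fin n))
      (chimera N N L) :=
  h.elim (fun h => ⟨_, h.2⟩) (fun h => ⟨_, h.2⟩)

lemma IsMinor.boxProd_comm {V V' W : Type*} {G : SimpleGraph V} {G' : SimpleGraph V'}
    {H : SimpleGraph W} (h : IsMinor (G □ G') H) : IsMinor (G' □ G) H :=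
  h.elim fun _ hφ => ⟨_, hφ.comp_iso (SimpleGraph.boxProdComm G' G)⟩

lemma cpcgEmbeds_two_mul {L : ℕ} (hL : 0 < L) (p n : ℕ) :
    CPCGEmbeds (2 * L * p) n L (p * (n + 1)) :=
  .inl ⟨nexusesFit_two_mul hL p n, isMinorEmbedding_cpcgChain hL p n⟩

lemma CPCGEmbeds.swap {m n L N : ℕ} (h : CPCGEmbeds m n L N) : CPCGEmbeds n m L N :=
  h.elim
    (fun h => .inr ⟨h.1, h.2.comp_iso (SimpleGraph.boxProdComm _ _)⟩)
    (fun h => .inl ⟨h.1, h.2.comp_iso (SimpleGraph.boxProdComm _ _)⟩)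

/-- As `2 ≤ L`, the bound `2 * L * p * (n + 1) ≤ 2 * (N * L + 1)` forces `p * (n + 1) ≤ N`. -/
lemma le_of_isMinor_chimera_two_mul {L p n N : ℕ} (hL : 2 ≤ L) (hn : Odd n)
    (h : IsMinor
      (SimpleGraph.completeGraph (Fin (2 * L * p)) □ SimpleGraph.completeGraph (Fin n))
      (chimera N N L)) : p * (n + 1) ≤ N := by
  have h1 := le_of_isMinor_chimera hn h
  by_contra hlt
  have h2 : (N + 1) * L ≤ p * (n + 1) * L := Nat.mul_le_mul_right _ (by omega)
  have h3 : 2 * L * p * (n + 1) = 2 * (p * (n + 1) * L) := by ring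
  rw [add_mul] at h2
  omega

theorem mainTheorem1 (L m n : ℕ) (hL : 2 ≤ L) (hm : 1 ≤ m) (hn : 1 ≤ n)
    (h : (2 * L ∣ m ∧ Odd n) ∨ (2 * L ∣ n ∧ Odd m)) :
    ∃ N : ℕ,
      IsLeast {N : ℕ | CPCGEmbeds m n L N} N ∧
      (2 * L ∣ m ∧ Odd n → 2 * L * N = m * (n + 1)) ∧
      (2 * L ∣ n ∧ Odd m → 2 * L * N = n * (m + 1)) ∧
      IsMinor (SimpleGraph.completeGraph (Fin m) □ SimpleGraph.completeGraph (Fin n))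
        (chimera N N L) ∧
      ∀ N' : ℕ, N' < N →
        ¬ IsMinor (SimpleGraph.completeGraph (Fin m) □ SimpleGraph.completeGraph (Fin n))
          (chimera N' N' L) := by
  -- The two cases exclude each other: a multiple of `2 * L` is not odd.
  have hexcl : ∀ {a : ℕ}, 2 * L ∣ a → ¬ Odd a := fun ha =>
    Nat.not_odd_iff_even.2 (even_iff_two_dvd.2 ((Dvd.intro _ rfl).trans ha))
  rcases h with ⟨⟨p, rfl⟩, hodd⟩ | ⟨⟨p, rfl⟩, hodd⟩
  · have hemb : CPCGEmbeds (2 * L * p) n L (p * (n + 1)) := cpcgEmbeds_two_mul (by omega) p n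
    refine ⟨p * (n + 1),
      ⟨hemb, fun N' hN' => le_of_isMinor_chimera_two_mul hL hodd hN'.isMinor⟩,
      fun _ => by ring, fun h => absurd hodd (hexcl h.1), hemb.isMinor,
      fun N' hlt hN' => hlt.not_ge (le_of_isMinor_chimera_two_mul hL hodd hN')⟩
  · have hemb : CPCGEmbeds m (2 * L * p) L (p * (m + 1)) :=
      (cpcgEmbeds_two_mul (by omega) p m).swap
    refine ⟨p * (m + 1),
      ⟨hemb, fun N' hN' => le_of_isMinor_chimera_two_mul hL hodd hN'.isMinor.boxProd_comm⟩,
      fun h => absurd hodd (hexcl h.1), fun _ => by ring, hemb.isMinor,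
      fun N' hlt hN' => hlt.not_ge (le_of_isMinor_chimera_two_mul hL hodd hN'.boxProd_comm)⟩
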